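/- Let $m$ be a positive integer, let $n=3m$, and regard $\mathbb F_{2^m}$ as a subfield of $\mathbb F_{2^n}$. For $x\in\mathbb F_{2^n}$ put $\mathrm{Tr}_m^{3m}(x)=x+x^{2^m}+x^{2^{2m}}$. For a function $F:\mathbb F_{2^n}\to\mathbb F_{2^n}$ and $c\in\mathbb F_{2^n}$, the $c$-differential uniformity of $F$ is $$ {}_c\Delta_F=\max\bigl\{\#\{X\in\mathbb F_{2^n}: F(X+a)-cF(X)=b\}\;:\; a,b\in\mathbb F_{2^n},\ a\neq 0 \text{ if } c=1\bigr\}; $$ $F$ is called P$c$N if ${}_c\Delta_F=1$ and AP$c$N if ${}_c\Delta_F=2$. For $\delta\in\mathbb F_{2^n}$ let $$F(X)=(X^{2^m}+X+\delta)^{2^{2m}+1}+X,\qquad X\in\mathbb F_{2^n}.$$ Then: 1. $F$ is P$c$N for all $c\in\mathbb F_{2^m}\setminus\{1\}$ and all $\delta\in\mathbb F_{2^n}$; 2. $F$ is AP$c$N for all $c\in\mathbb F_{2^n}\setminus\mathbb F_{2^m}$ and all $\delta\in\mathbb F_{2^n}$ with $\mathrm{Tr}_m^{3m}(\delta)=1$;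 3. ${}_c\Delta_F\le 4$ for all $c\in\mathbb F_{2^n}\setminus\mathbb F_{2^m}$ and all $\delta\in\mathbb F_{2^n}$ with $\mathrm{Tr}_m^{3m}(\delta)\neq 1$. -/

import Mathlib

/-- The relative trace `Tr_m^n : 𝔽_{p^n} → 𝔽_{p^m}` (for `m ∣ n`), given by
`x ↦ ∑_{i=0}^{(n-m)/m} x^{p^{mi}}`, with its value regarded as an element of the big field. -/
def relTrace {K : Type*} [Field K] (p m n : ℕ) (x : K) : K :=
  ∑ i ∈ Finset.range ((n - m) / m + 1), x ^ p ^ (m * i)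

/-- The entry at `(a, b)` of the `c`-difference distribution table of `F`: the number of
solutions `X` of `F (X + a) - c F(X) = b`. -/
def cDDT {K : Type*} [Field K] [Fintype K] [DecidableEq K] (F : K → K) (c a b : K) : ℕ :=
  (Finset.univ.filter fun X : K => F (X + a) - c * F X = b).card

/-- The `c`-differential uniformity of `F`: the maximum of the entries at `(a, b)` of the
`c`-difference distribution table, over all `a, b`, with `a ≠ 0` if `c = 1`. -/
def cDifferentialUniformity {K : Type*} [Field K] [Fintype K] [DecidableEq K]
    (F : K → K) (c : K) : ℕ :=
  (Finset.univ.filter fun ab : K × K => c = 1 → ab.1 ≠ 0).sup fun ab => cDDT F c ab.1 ab.2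

/-- Perfect `c`-nonlinear functions. -/
def IsPcN {K : Type*} [Field K] [Fintype K] [DecidableEq K] (F : K → K) (c : K) : Prop :=
  cDifferentialUniformity F c = 1

/-- Almost perfect `c`-nonlinear functions. -/
def IsAPcN {K : Type*} [Field K] [Fintype K] [DecidableEq K] (F : K → K) (c : K) : Prop :=
  cDifferentialUniformity F c = 2

/-- The function `F(X) = (X^{2^m} + X + δ)^{2^{2m}+1} + X`. -/
def permF {K : Type*} [Field K] (m : ℕ) (δ : K) (X : K) : K :=
  (X ^ 2 ^ m + X + δ) ^ (2 ^ (2 * m) + 1) + X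

set_option linter.unusedSimpArgs false

/-! Put `σ x = x ^ 2 ^ m`, so that `σ` has cube the identity and fixed field `k`. Fix `a`, a
solution `x` and a second solution `x + d`, and set `D = σ d + d`, `A = σ a + a`, `g = (1 + c)⁻¹`,
`t = Tr δ + 1`. The equation gives `d` as an expression in `D`, so counting `d` is counting `D`.
Adding this expression to its image under `σ` removes `x`: `D ^ 2 + t * D + (g + σ g) * w = 0`,
where `w = D * σ A + A * σ D` is fixed by `σ`. If `c ∈ k`, then `g + σ g = 0`, and `D = t` would be
fixed of trace zero, so `D = 0`. If `t = 0`, write `g + σ g = s ^ 2`; then `D = s * r` with `r`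
fixed, and `r` has two possible values. If `t ≠ 0` and `A ≠ 0`, then `w` determines `D` and is a
root of a quartic. -/

/-- A monic quartic without constant term has at most four roots. -/
lemma card_roots_quartic_le {K : Type*} [Field K] [Fintype K] [DecidableEq K] (e t k v : K) :
    (Finset.univ.filter fun w : K =>
      (w ^ 2 + e * w) ^ 2 + t * (w ^ 2 + e * w) + k * v * w = 0).card ≤ 4 := by
  open Polynomial in
  let p : K[X] := (X ^ 2 + C e * X) ^ 2 + C t * (X ^ 2 + C e * X) + C (k * v) * X
  have hp : p.natDegree = 4 := by
    simp only [p]; compute_degree!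
  have hp0 : p ≠ 0 := by
    rintro h
    simp [h] at hp
  refine le_trans (Finset.card_le_card (t := p.roots.toFinset) ?_)
    ((Multiset.toFinset_card_le _).trans ((Polynomial.card_roots' p).trans hp.le))
  intro w hw
  rw [Multiset.mem_toFinset, Polynomial.mem_roots hp0]
  simpa [p] using hw

/-! ### Identities for a ring endomorphism whose cube is the identity, in characteristic two. -/

section Algebra

variable {K : Type*} [Field K] [CharP K 2]

/-- Lets `simp` remove the even coefficients that `ring_nf` leaves behind. -/
lemma four_eq_zero_of_char_two : (4 : K) = 0 := by
  linear_combination 2 * (CharTwo.two_eq_zero : (2 : K) = 0)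

/-- If `X` and `X + d` have the same image under the `c`-derivative, then `D = σ d + d` is a root
of an additive polynomial that does not depend on `X`. -/
lemma quadratic_of_fixed {d₀ d₁ d₂ a₀ a₁ u₀ u₁ u₂ g₀ g₁ : K}
    (h₀ : d₀ = u₀ * (d₀ + d₂) + (d₁ + d₀) * u₂ + (d₁ + d₀) * (d₀ + d₂)
      + g₀ * ((d₁ + d₀) * a₁ + a₀ * (d₂ + d₁)))
    (h₁ : d₁ = u₁ * (d₁ + d₀) + (d₂ + d₁) * u₀ + (d₂ + d₁) * (d₁ + d₀)
      + g₁ * ((d₁ + d₀) * a₁ + a₀ * (d₂ + d₁))) :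
    (d₁ + d₀) ^ 2 + (u₀ + u₁ + u₂ + 1) * (d₁ + d₀)
      + (g₀ + g₁) * ((d₁ + d₀) * a₁ + a₀ * (d₂ + d₁)) = 0 := by
  linear_combination (norm := (ring_nf; simp [CharTwo.two_eq_zero, four_eq_zero_of_char_two])) h₀ + h₁

/-- The `c`-derivative takes the same value at `X` and `X + d` if and only if `d` satisfies an
equation involving `d` only through `σ d + d`. -/
lemma derivative_add_eq_iff (σ : K →+* K) (hσ : ∀ x, σ (σ (σ x)) = x) {F : K → K} {δ : K}
    (hF : ∀ x, F x = (σ x + x + δ) * σ (σ (σ x + x + δ)) + x) {c g a : K}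
    (hg : (1 + c) * g = 1) (x d : K) :
    F (x + d + a) - c * F (x + d) = F (x + a) - c * F x ↔
      d = (σ x + x + δ) * (d + σ (σ d)) + (σ d + d) * σ (σ (σ x + x + δ))
        + (σ d + d) * (d + σ (σ d))
        + g * ((σ d + d) * (σ (σ a) + σ a) + (σ a + a) * (σ (σ d) + σ d)) := by
  have hc : 1 + c ≠ 0 := left_ne_zero_of_mul_eq_one hg
  simp only [hF, map_add, hσ]
  constructor
  · intro h
    refine mul_left_cancel₀ hc ?_
    linear_combination (norm := (ring_nf; simp [CharTwo.two_eq_zero, four_eq_zero_of_char_two])) h +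
      ((σ d + d) * (σ (σ a) + σ a) + (σ a + a) * (σ (σ d) + σ d)) * hg
  · intro h
    linear_combination (norm := (ring_nf; simp [CharTwo.two_eq_zero, four_eq_zero_of_char_two])) (1 + c) * h +
      ((σ d + d) * (σ (σ a) + σ a) + (σ a + a) * (σ (σ d) + σ d)) * hg

/-- A fixed element of an automorphism of order three that has trace zero vanishes. -/
lemma eq_zero_of_fixed_of_trace (σ : K →+* K) {x : K} (h : σ x = x)
    (ht : x + σ x + σ (σ x) = 0) : x = 0 := by
  rw [h, h] at ht
  linear_combination (norm := (ring_nf; simp [CharTwo.two_eq_zero, four_eq_zero_of_char_two])) ht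

/-- The form `D * σ A + A * σ D` on elements of trace zero takes fixed values. -/
lemma form_fixed (σ : K →+* K) (hσ : ∀ x, σ (σ (σ x)) = x) (x y : K) :
    σ ((σ x + x) * (σ (σ y) + σ y) + (σ y + y) * (σ (σ x) + σ x)) =
      (σ x + x) * (σ (σ y) + σ y) + (σ y + y) * (σ (σ x) + σ x) := by
  simp only [map_add, map_mul, hσ]
  linear_combination (norm := (ring_nf; simp [CharTwo.two_eq_zero, four_eq_zero_of_char_two]))

/-- The necessary condition on the difference of two solutions of the `c`-difference equation. -/
lemma quadratic_of_derivative_eq (σ : K →+* K) (hσ : ∀ x, σ (σ (σ x)) = x) {F : K → K} {δ : K}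
    (hF : ∀ x, F x = (σ x + x + δ) * σ (σ (σ x + x + δ)) + x) {c g a : K}
    (hg : (1 + c) * g = 1) {x d : K}
    (h : F (x + d + a) - c * F (x + d) = F (x + a) - c * F x) :
    (σ d + d) ^ 2 + (δ + σ δ + σ (σ δ) + 1) * (σ d + d) + (g + σ g) *
      ((σ d + d) * (σ (σ a) + σ a) + (σ a + a) * (σ (σ d) + σ d)) = 0 := by
  rw [derivative_add_eq_iff σ hσ hF hg] at h
  have h' := congrArg (⇑σ) h
  rw [map_add, map_mul σ g, form_fixed σ hσ] at h'
  simp only [map_add, map_mul, hσ] at h h'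
  linear_combination (norm := (ring_nf; simp [CharTwo.two_eq_zero, four_eq_zero_of_char_two])) h + h'

/-- A difference `d` of two solutions is determined by `σ d + d`. -/
lemma eq_of_derivative_eq (σ : K →+* K) (hσ : ∀ x, σ (σ (σ x)) = x) {F : K → K} {δ : K}
    (hF : ∀ x, F x = (σ x + x + δ) * σ (σ (σ x + x + δ)) + x) {c g a : K}
    (hg : (1 + c) * g = 1) {x d e : K}
    (hd : F (x + d + a) - c * F (x + d) = F (x + a) - c * F x)
    (he : F (x + e + a) - c * F (x + e) = F (x + a) - c * F x)
    (h : σ d + d = σ e + e) : d = e := by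
  rw [derivative_add_eq_iff σ hσ hF hg] at hd he
  have h1 : σ (σ d) + σ d = σ (σ e) + σ e := by rw [← map_add, h, map_add]
  have h2 : d + σ (σ d) = e + σ (σ e) := by
    linear_combination (norm := (ring_nf; simp [CharTwo.two_eq_zero, four_eq_zero_of_char_two]))
      h1 - h
  rw [hd, he, h, h1, h2]

/-- Conversely, a trace-zero solution `D` of the quadratic condition comes from a second
solution `x + d` with `σ d + d = D`. -/
lemma exists_derivative_eq (σ : K →+* K) (hσ : ∀ x, σ (σ (σ x)) = x) {F : K → K} {δ : K}
    (hF : ∀ x, F x = (σ x + x + δ) * σ (σ (σ x + x + δ)) + x) {c g a : K}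
    (hg : (1 + c) * g = 1) (x : K) {D : K} (ht : D + σ D + σ (σ D) = 0)
    (hD : D ^ 2 + (δ + σ δ + σ (σ δ) + 1) * D +
      (g + σ g) * (D * (σ (σ a) + σ a) + (σ a + a) * σ D) = 0) :
    ∃ d, σ d + d = D ∧ F (x + d + a) - c * F (x + d) = F (x + a) - c * F x := by
  have hD2 : σ (σ D) = D + σ D := by
    linear_combination (norm := (ring_nf; simp [CharTwo.two_eq_zero, four_eq_zero_of_char_two])) ht
  -- The candidate `d` is forced: it is the right side of `derivative_add_eq_iff` with `D` for `σ d
  -- + d`. Its consistency `σ d + d = D` is exactly `hD`.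
  have key : σ ((σ x + x + δ) * σ (σ D) + D * σ (σ (σ x + x + δ)) + D * σ (σ D)
        + g * (D * (σ (σ a) + σ a) + (σ a + a) * σ D)) +
        ((σ x + x + δ) * σ (σ D) + D * σ (σ (σ x + x + δ)) + D * σ (σ D)
        + g * (D * (σ (σ a) + σ a) + (σ a + a) * σ D)) = D := by
    simp only [map_add, map_mul, hσ, hD2]
    linear_combination (norm := (ring_nf; simp [CharTwo.two_eq_zero, four_eq_zero_of_char_two])) hD
  set d := (σ x + x + δ) * σ (σ D) + D * σ (σ (σ x + x + δ)) + D * σ (σ D)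
        + g * (D * (σ (σ a) + σ a) + (σ a + a) * σ D) with hd
  refine ⟨d, key, ?_⟩
  rw [derivative_add_eq_iff σ hσ hF hg]
  have e1 : σ (σ d) + σ d = σ D := by rw [← map_add, key]
  have e2 : d + σ (σ d) = σ (σ D) := by
    rw [hD2]
    linear_combination (norm := (ring_nf; simp [CharTwo.two_eq_zero, four_eq_zero_of_char_two])) e1 + key
  rw [key, e1, e2]

/-- For `τ ≠ 0` the value `w = D * σ A + A * σ D` determines `D` and is a root of a monic
quartic. -/
lemma quartic_of_quadratic {D₀ D₁ A₀ A₁ t w₀ w₁ w : K}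
    (hw : w = D₀ * A₁ + A₀ * D₁)
    (h₀ : D₀ ^ 2 + t * D₀ + w₀ * w = 0) (h₁ : D₁ ^ 2 + t * D₁ + w₁ * w = 0) :
    t * A₁ * (A₀ + A₁) * D₀ = w ^ 2 + (w₀ * A₁ ^ 2 + w₁ * A₀ ^ 2 + t * A₀) * w ∧
    (w ^ 2 + (w₀ * A₁ ^ 2 + w₁ * A₀ ^ 2 + t * A₀) * w) ^ 2 +
      t * (t * A₁ * (A₀ + A₁)) * (w ^ 2 + (w₀ * A₁ ^ 2 + w₁ * A₀ ^ 2 + t * A₀) * w) +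
      (t * A₁ * (A₀ + A₁)) ^ 2 * w₀ * w = 0 := by
  have h : t * A₁ * (A₀ + A₁) * D₀ = w ^ 2 + (w₀ * A₁ ^ 2 + w₁ * A₀ ^ 2 + t * A₀) * w := by
    have hw2 : w ^ 2 = D₀ ^ 2 * A₁ ^ 2 + A₀ ^ 2 * D₁ ^ 2 := by
      rw [hw]; linear_combination (norm := (ring_nf; simp [CharTwo.two_eq_zero, four_eq_zero_of_char_two]))
    linear_combination (norm := (ring_nf; simp [CharTwo.two_eq_zero, four_eq_zero_of_char_two]))
      hw2 + A₁ ^ 2 * h₀ + A₀ ^ 2 * h₁ + t * A₀ * hw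
  refine ⟨h, ?_⟩
  rw [← h]
  linear_combination (t * A₁ * (A₀ + A₁)) ^ 2 * h₀


end Algebra

/-! ### Counting solutions over the finite field. -/

section Finite

variable {K : Type*} [Field K] [Fintype K] [DecidableEq K]

/-- The set of differences from `x` of the points where the `c`-derivative in direction `a` takes
the same value as at `x`. -/
def derivativeFiber (F : K → K) (c a x : K) : Finset K :=
  Finset.univ.filter fun d => F (x + d + a) - c * F (x + d) = F (x + a) - c * F x

lemma mem_derivativeFiber {F : K → K} {c a x d : K} : d ∈ derivativeFiber F c a x ↔
    F (x + d + a) - c * F (x + d) = F (x + a) - c * F x := by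
  simp [derivativeFiber]

lemma cDDT_eq_card_derivativeFiber (F : K → K) (c a x : K) :
    cDDT F c a (F (x + a) - c * F x) = (derivativeFiber F c a x).card := by
  refine Finset.card_bij (fun y _ => y - x) ?_ ?_ ?_
  · intro y hy
    simpa [derivativeFiber] using hy
  · intro y _ z _ h
    exact sub_left_injective h
  · intro d hd
    refine ⟨x + d, ?_, by ring⟩
    simpa [derivativeFiber] using hd

lemma cDifferentialUniformity_le {F : K → K} {c : K} {N : ℕ}
    (h : ∀ a x, (derivativeFiber F c a x).card ≤ N) : cDifferentialUniformity F c ≤ N := by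
  refine Finset.sup_le ?_
  rintro ⟨a, b⟩ -
  by_cases hb : ∃ x, F (x + a) - c * F x = b
  · obtain ⟨x, rfl⟩ := hb
    exact (cDDT_eq_card_derivativeFiber F c a x).trans_le (h a x)
  · have : cDDT F c a b = 0 := by
      rw [cDDT, Finset.card_eq_zero, Finset.filter_eq_empty_iff]
      exact fun x _ hx => hb ⟨x, hx⟩
    exact this.trans_le (Nat.zero_le _)

lemma card_derivativeFiber_le {F : K → K} {c : K} (hc : c ≠ 1) (a x : K) :
    (derivativeFiber F c a x).card ≤ cDifferentialUniformity F c := by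
  rw [← cDDT_eq_card_derivativeFiber]
  exact Finset.le_sup (f := fun ab : K × K => cDDT F c ab.1 ab.2)
    (b := (a, F (x + a) - c * F x)) (by simp [hc])

/-- A subfield with `q` elements consists of the roots of `X ^ q - X`. -/
lemma mem_subfield_iff_pow_card_eq {k : Subfield K} {q : ℕ} (hq : 1 < q) (hk : Nat.card k = q)
    (x : K) : x ∈ k ↔ x ^ q = x := by
  classical
  have hmem : ∀ y ∈ k, y ^ q = y := fun y hy => by
    have := FiniteField.pow_card (⟨y, hy⟩ : k)
    rw [← Nat.card_eq_fintype_card, hk] at this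
    exact congrArg Subtype.val this
  refine ⟨hmem x, fun hx => ?_⟩
  have hne := FiniteField.X_pow_card_sub_X_ne_zero K hq
  have hroots : ∀ y : K, y ∈ (Polynomial.X ^ q - Polynomial.X : Polynomial K).roots.toFinset ↔
      y ^ q = y := by
    simp [hne, sub_eq_zero]
  have hsub : (Finset.univ.filter (· ∈ k)) ⊆
      (Polynomial.X ^ q - Polynomial.X : Polynomial K).roots.toFinset := by
    intro y hy
    exact (hroots y).2 (hmem y (by simpa using hy))
  have heq := Finset.eq_of_subset_of_card_le hsub (by
    refine (Multiset.toFinset_card_le _).trans ((Polynomial.card_roots' _).trans ?_)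
    rw [FiniteField.X_pow_card_sub_X_natDegree_eq K hq, ← hk, Nat.card_eq_fintype_card,
      Fintype.card_subtype])
  have hx' := (hroots x).2 hx
  rw [← heq] at hx'
  simpa using hx'

variable [CharP K 2]

/-- The hypothesis kills the `w` term, leaving `D * (D + t) = 0`. Since `t` is fixed by `σ` and `D`
has trace zero, both roots give `D = 0`. -/
lemma card_derivativeFiber_le_one (σ : K →+* K) (hσ : ∀ x, σ (σ (σ x)) = x) {F : K → K} {δ : K}
    (hF : ∀ x, F x = (σ x + x + δ) * σ (σ (σ x + x + δ)) + x) {c g : K}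
    (hg : (1 + c) * g = 1) (a x : K)
    (h : (g + σ g) * (σ a + a) = 0) : (derivativeFiber F c a x).card ≤ 1 := by
  have h0 : ∀ d ∈ derivativeFiber F c a x, σ d + d = 0 := by
    intro d hd
    have hq := quadratic_of_derivative_eq σ hσ hF hg (mem_derivativeFiber.1 hd)
    have hz : (g + σ g) *
        ((σ d + d) * (σ (σ a) + σ a) + (σ a + a) * (σ (σ d) + σ d)) = 0 := by
      rcases mul_eq_zero.1 h with h | h
      · rw [h, zero_mul]
      · rw [← map_add, h]; simp
    rw [hz, add_zero] at hq
    have hq' : (σ d + d) * (σ d + d + (δ + σ δ + σ (σ δ) + 1)) = 0 := by linear_combination hq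
    rcases mul_eq_zero.1 hq' with h1 | h1
    · exact h1
    · have h2 : σ d + d = δ + σ δ + σ (σ δ) + 1 := CharTwo.add_eq_zero.1 h1
      refine eq_zero_of_fixed_of_trace σ ?_ ?_
      · rw [h2]
        simp only [map_add, map_one, hσ]
        ring
      · simp only [map_add, hσ]
        linear_combination (norm := (ring_nf; simp [CharTwo.two_eq_zero, four_eq_zero_of_char_two]))
  rw [Finset.card_le_one]
  intro d hd e he
  exact eq_of_derivative_eq σ hσ hF hg (mem_derivativeFiber.1 hd) (mem_derivativeFiber.1 he)
    ((h0 d hd).trans (h0 e he).symm)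

/-- The map `d ↦ w` is injective into the roots of one quartic. Injectivity needs `k ≠ 0`, whose
last factor `A + σ A` is `σ (σ A)` because `A` has trace zero. -/
lemma card_derivativeFiber_le_four (σ : K →+* K) (hσ : ∀ x, σ (σ (σ x)) = x) {F : K → K} {δ : K}
    (hF : ∀ x, F x = (σ x + x + δ) * σ (σ (σ x + x + δ)) + x) {c g : K}
    (hg : (1 + c) * g = 1) (hδ : δ + σ δ + σ (σ δ) ≠ 1) (a x : K) :
    (derivativeFiber F c a x).card ≤ 4 := by
  by_cases ha : σ a + a = 0
  · exact (card_derivativeFiber_le_one σ hσ hF hg a x (by rw [ha, mul_zero])).trans (by norm_num)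
  set t := δ + σ δ + σ (σ δ) + 1 with ht
  have ht0 : t ≠ 0 := fun h => hδ (CharTwo.add_eq_zero.1 h)
  have htσ : σ t = t := by
    rw [ht]
    simp only [map_add, map_one, hσ]
    ring
  set A := σ a + a with hA
  have hA1 : σ A ≠ 0 := (map_ne_zero σ).2 ha
  have hA2 : A + σ A ≠ 0 := by
    have : σ (σ A) = A + σ A := by
      simp only [hA, map_add, hσ]
      linear_combination (norm := (ring_nf; simp [CharTwo.two_eq_zero, four_eq_zero_of_char_two]))
    rw [← this]
    exact (map_ne_zero σ).2 hA1
  have hk : t * σ A * (A + σ A) ≠ 0 := mul_ne_zero (mul_ne_zero ht0 hA1) hA2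
  set k := t * σ A * (A + σ A)
  set e := (g + σ g) * σ A ^ 2 + σ (g + σ g) * A ^ 2 + t * A
  have key : ∀ d ∈ derivativeFiber F c a x,
      k * (σ d + d) = ((σ d + d) * σ A + A * σ (σ d + d)) ^ 2 +
        e * ((σ d + d) * σ A + A * σ (σ d + d)) ∧
      (((σ d + d) * σ A + A * σ (σ d + d)) ^ 2 +
        e * ((σ d + d) * σ A + A * σ (σ d + d))) ^ 2 +
      t * k * (((σ d + d) * σ A + A * σ (σ d + d)) ^ 2 +
        e * ((σ d + d) * σ A + A * σ (σ d + d))) +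
      k ^ 2 * (g + σ g) * ((σ d + d) * σ A + A * σ (σ d + d)) = 0 := fun d hd => by
    have h := quadratic_of_derivative_eq σ hσ hF hg (mem_derivativeFiber.1 hd)
    have h' := congrArg (⇑σ) h
    rw [← map_add σ (σ d) d, ← map_add σ (σ a) a] at h
    rw [map_add, map_mul σ (g + σ g), form_fixed σ hσ, map_zero, map_add, map_pow, map_mul,
      ← ht, htσ, ← map_add σ (σ d) d, ← map_add σ (σ a) a] at h'
    exact quartic_of_quadratic (A₀ := A) (A₁ := σ A) rfl h h'
  refine le_trans (Finset.card_le_card_of_injOn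
    (fun d => (σ d + d) * σ A + A * σ (σ d + d)) (fun d hd => ?_) ?_)
    (card_roots_quartic_le e (t * k) (k ^ 2) (g + σ g))
  · simpa using (key d hd).2
  · intro d hd d' hd' h
    refine eq_of_derivative_eq σ hσ hF hg (mem_derivativeFiber.1 hd) (mem_derivativeFiber.1 hd')
      (mul_left_cancel₀ hk ?_)
    simp only at h
    rw [(key d hd).1, (key d' hd').1, h]

/-- If `δ` has trace one, then `σ d + d` takes only the two values `0` and `s * e` on the fiber,
where `s ^ 2 = g + σ g` and `e` does not depend on `d`. -/
lemma card_derivativeFiber_le_two (σ : K →+* K) (hσ : ∀ x, σ (σ (σ x)) = x) {F : K → K} {δ : K}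
    (hF : ∀ x, F x = (σ x + x + δ) * σ (σ (σ x + x + δ)) + x) {c g s : K}
    (hg : (1 + c) * g = 1) (hδ : δ + σ δ + σ (σ δ) = 1) (hs0 : s ≠ 0) (hs : g + σ g = s * s)
    (a x : K) : (derivativeFiber F c a x).card ≤ 2 := by
  refine le_trans (Finset.card_le_card_of_injOn (t := {0, s * (s * (σ (σ a) + σ a) +
    (σ a + a) * σ s)}) (fun d => σ d + d) (fun d hd => ?_) ?_) Finset.card_le_two
  · have h := quadratic_of_derivative_eq σ hσ hF hg (mem_derivativeFiber.1 hd)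
    have hW := form_fixed σ hσ d a
    rw [hδ, CharTwo.add_self_eq_zero, zero_mul, add_zero, hs] at h
    -- Dividing by `s ^ 2` makes `r ^ 2` equal to the fixed form `w`, so `r` is fixed as squaring is
    -- injective.
    obtain ⟨r, hr⟩ : ∃ r, σ d + d = s * r := ⟨(σ d + d) / s, by field_simp⟩
    have hσr : σ (σ d) + σ d = σ s * σ r := by rw [← map_add, hr, map_mul]
    rw [hr, hσr] at h hW
    have hr2 : r ^ 2 = s * r * (σ (σ a) + σ a) + (σ a + a) * (σ s * σ r) := by
      refine CharTwo.add_eq_zero.1 (mul_left_cancel₀ (mul_ne_zero hs0 hs0) ?_)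
      linear_combination h
    rw [← hr2, map_pow] at hW
    have hrr : σ r = r := CharTwo.sq_injective hW
    rw [hrr] at hr2
    simp only [Finset.coe_insert, Finset.coe_singleton, Set.mem_insert_iff,
      Set.mem_singleton_iff, hr]
    by_cases hr0 : r = 0
    · left; rw [hr0, mul_zero]
    · right
      congr 1
      exact mul_left_cancel₀ hr0 (by linear_combination hr2)
  · intro d hd e he hde
    exact eq_of_derivative_eq σ hσ hF hg (mem_derivativeFiber.1 hd) (mem_derivativeFiber.1 he) hde

lemma exists_two_le_card_derivativeFiber (σ : K →+* K) (hσ : ∀ x, σ (σ (σ x)) = x) {F : K → K}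
    {δ : K} (hF : ∀ x, F x = (σ x + x + δ) * σ (σ (σ x + x + δ)) + x) {c g s : K}
    (hg : (1 + c) * g = 1) (hδ : δ + σ δ + σ (σ δ) = 1) (hs0 : s ≠ 0) (hs : g + σ g = s * s) :
    ∃ a x, 2 ≤ (derivativeFiber F c a x).card := by
  have hts : s + σ s + σ (σ s) = 0 := by
    refine CharTwo.sq_injective ?_
    have h1 := congrArg (⇑σ) hs
    have h2 := congrArg (⇑σ) h1
    simp only [map_add, map_mul, hσ] at h1 h2
    change (s + σ s + σ (σ s)) ^ 2 = 0 ^ 2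
    linear_combination (norm := (ring_nf; simp [CharTwo.two_eq_zero, four_eq_zero_of_char_two]))
      hs + h1 + h2
  have hs1 : σ s ≠ 0 := (map_ne_zero σ).2 hs0
  have hs2 : σ (σ s) ≠ 0 := (map_ne_zero σ).2 hs1
  have hss : σ (σ s) = s + σ s := by
    linear_combination (norm := (ring_nf; simp [CharTwo.two_eq_zero, four_eq_zero_of_char_two])) hts
  -- This `a` makes the second possible value of `r` equal to `1`, so that `D = s`, which has trace
  -- zero, is a nonzero solution.
  obtain ⟨a, ha⟩ : ∃ a, a * σ s = 1 := ⟨(σ s)⁻¹, inv_mul_cancel₀ hs1⟩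
  have ha1 := congrArg (⇑σ) ha
  have ha2 := congrArg (⇑σ) ha1
  simp only [map_mul, hσ, map_one] at ha1 ha2
  have he : s * (σ (σ a) + σ a) + (σ a + a) * σ s = 1 := by
    rw [hss] at ha1
    linear_combination (norm := (ring_nf; simp [CharTwo.two_eq_zero, four_eq_zero_of_char_two]))
      ha + ha1 + ha2
  obtain ⟨d, hd, hd'⟩ := exists_derivative_eq σ hσ hF (a := a) hg 0 hts (by
    rw [hδ, hs, he]
    linear_combination (norm := (ring_nf; simp [CharTwo.two_eq_zero, four_eq_zero_of_char_two])))
  have hd0 : d ≠ 0 := by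
    rintro rfl
    simp [hs0.symm] at hd
  refine ⟨a, 0, ?_⟩
  rw [← Finset.card_pair hd0.symm]
  refine Finset.card_le_card ?_
  intro y hy
  rcases Finset.mem_insert.1 hy with rfl | hy
  · simp [mem_derivativeFiber]
  · rw [Finset.mem_singleton.1 hy]
    exact mem_derivativeFiber.2 hd'

end Finite

theorem theorem3p3 {K : Type*} [Field K] [Fintype K] [DecidableEq K] (m : ℕ) (hm : 0 < m)
    (hK : Fintype.card K = 2 ^ (3 * m)) (k : Subfield K) (hk : Nat.card k = 2 ^ m) :
    (∀ c : K, c ∈ k → c ≠ 1 → ∀ δ : K, IsPcN (permF m δ) c) ∧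
    (∀ c : K, c ∉ k → ∀ δ : K, relTrace 2 m (3 * m) δ = 1 → IsAPcN (permF m δ) c) ∧
    (∀ c : K, c ∉ k → ∀ δ : K, relTrace 2 m (3 * m) δ ≠ 1 →
      cDifferentialUniformity (permF m δ) c ≤ 4) := by
  have : Fact (Nat.Prime 2) := ⟨Nat.prime_two⟩
  have : CharP K 2 := charP_of_card_eq_prime_pow hK
  let σ : K →+* K := iterateFrobenius K 2 m
  have hσ1 (x : K) : σ x = x ^ 2 ^ m := iterateFrobenius_def 2 m x
  have hσ2 (x : K) : σ (σ x) = x ^ 2 ^ (2 * m) := by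
    rw [hσ1, hσ1, ← pow_mul, ← pow_add, two_mul]
  have hσ (x : K) : σ (σ (σ x)) = x := by
    rw [hσ2, hσ1, ← pow_mul, ← pow_add, show m + 2 * m = 3 * m by ring, ← hK,
      FiniteField.pow_card]
  have hmem (x : K) : x ∈ k ↔ σ x = x := by
    rw [hσ1]
    exact mem_subfield_iff_pow_card_eq (Nat.one_lt_two_pow hm.ne') hk x
  have hF (δ x : K) : permF m δ x = (σ x + x + δ) * σ (σ (σ x + x + δ)) + x := by
    rw [hσ2, hσ1, permF, pow_succ']
  have hT (δ : K) : relTrace 2 m (3 * m) δ = δ + σ δ + σ (σ δ) := by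
    rw [relTrace, show (3 * m - m) / m = 2 by
      rw [show 3 * m - m = 2 * m by omega, Nat.mul_div_cancel _ hm]]
    simp [Finset.sum_range_succ, hσ1, hσ2, mul_comm m 2, ← pow_mul, ← pow_add, two_mul]
  have hg {c : K} (hc : c ≠ 1) : (1 + c) * (1 + c)⁻¹ = 1 :=
    mul_inv_cancel₀ fun h => hc (CharTwo.add_eq_zero.1 h).symm
  have hne {c : K} (hc : c ∉ k) : c ≠ 1 := by
    rintro rfl
    exact hc k.one_mem
  refine ⟨fun c hc hc1 δ => ?_, fun c hc δ hδ => ?_, fun c hc δ hδ => ?_⟩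
  · refine le_antisymm (cDifferentialUniformity_le fun a x => ?_) ?_
    · refine card_derivativeFiber_le_one σ hσ (hF δ) (hg hc1) a x ?_
      rw [map_inv₀, map_add, map_one, (hmem c).1 hc, CharTwo.add_self_eq_zero, zero_mul]
    · refine le_trans ?_ (card_derivativeFiber_le hc1 0 0)
      exact Finset.card_pos.2 ⟨0, by simp [mem_derivativeFiber]⟩
  · rw [hT] at hδ
    obtain ⟨s, hs⟩ := FiniteField.isSquare_of_char_two (ringChar.eq_iff.2 ‹CharP K 2›)
      ((1 + c)⁻¹ + σ (1 + c)⁻¹)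
    -- If `s = 0`, then `g`, hence `c`, is fixed by `σ` and lies in `k`.
    have hs0 : s ≠ 0 := by
      rintro rfl
      rw [mul_zero, CharTwo.add_eq_zero, map_inv₀, inv_inj, map_add, map_one,
        add_right_inj] at hs
      exact hc ((hmem c).2 hs.symm)
    refine le_antisymm (cDifferentialUniformity_le fun a x =>
      card_derivativeFiber_le_two σ hσ (hF δ) (hg (hne hc)) hδ hs0 hs a x) ?_
    obtain ⟨a, x, h⟩ :=
      exists_two_le_card_derivativeFiber σ hσ (hF δ) (hg (hne hc)) hδ hs0 hs
    exact h.trans (card_derivativeFiber_le (hne hc) a x)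
  · rw [hT] at hδ
    exact cDifferentialUniformity_le fun a x =>
      card_derivativeFiber_le_four σ hσ (hF δ) (hg (hne hc)) hδ a x
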